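/- All spaces are arbitrary topological spaces (no separation axioms). A function $f:X\to\mathbb R$ is scatteredly continuous if for every non-empty subspace $A\subset X$ the restriction $f|A$ has a point of continuity; $SC_p(X)\subset\mathbb R^X$ denotes the space of all scatteredly continuous functions $f:X\to\mathbb R$ with the topology of pointwise convergence. The weight $w(Z)$ is the smallest cardinality of a base of the topology of $Z$, the density $d(Z)$ is the smallest cardinality of a dense subset of $Z$, and the Lindelöf number $l(Z)$ is the smallest infinite cardinal $\kappa$ such that each open cover of $Z$ has a subcover of cardinality $\le\kappa$; put $hl(X)=\sup\{l(Z):Z\subset X\}$ and $hd(X)=\sup\{d(Z):Z\subset X\}$. The space $X$ has countable tightness if for every $A\subset X$ and every $a\in\overline A$ there is a countable set $B\subset A$ with $a\in\overline B$. Let $X$ be a topological space of countable tightness. Then every compact convex subset $K\subset SC_p(X)$ has weight $w(K)\le\max\{hl(X),hd(X)\}$. Consequently $$\sup\{w(K): K\text{ is a compact convex subset of }SC_p(X)\}\le\max\{hl(X),hd(X)\},$$ and, if $X$ is non-empty, then moreover $$hl(X)\le\sup\{w(K): K\text{ is a compact convex subset of }SC_p(X)\}.$$ -/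

import Mathlib

open Set TopologicalSpace
open scoped Cardinal

universe u

noncomputable section

namespace SCp

/-- A function between topological spaces is scatteredly continuous if its restriction to every
non-empty subspace `A` has a point of continuity. -/
def ScatteredlyContinuous {X Y : Type*} [TopologicalSpace X] [TopologicalSpace Y]
    (f : X → Y) : Prop :=
  ∀ A : Set X, A.Nonempty → ∃ a : A, ContinuousAt (A.domRestrict f) a

/-- The scatteredly continuous real-valued functions on `X`, as a subset of `X → ℝ`, which carries
the product topology, that is, the topology of pointwise convergence. -/
def scatteredlyContinuousFunctions (X : Type*) [TopologicalSpace X] : Set (X → ℝ) :=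
  {f | ScatteredlyContinuous f}

/-- The weight: the smallest cardinality of a base of the topology. -/
def weight (X : Type u) [TopologicalSpace X] : Cardinal.{u} :=
  sInf {κ | ∃ B : Set (Set X), IsTopologicalBasis B ∧ #B = κ}

/-- The tightness: the smallest infinite cardinal `κ` such that each point in the closure of a set
`A` is in the closure of a subset of `A` of cardinality at most `κ`. -/
def tightness (X : Type u) [TopologicalSpace X] : Cardinal.{u} :=
  sInf {κ | ℵ₀ ≤ κ ∧ ∀ (A : Set X) (a : X), a ∈ closure A → ∃ B ⊆ A, #B ≤ κ ∧ a ∈ closure B}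

/-- The Lindelöf number: the smallest infinite cardinal `κ` such that each open cover has a
subcover of cardinality at most `κ`. -/
def lindelofNumber (X : Type u) [TopologicalSpace X] : Cardinal.{u} :=
  sInf {κ | ℵ₀ ≤ κ ∧ ∀ U : Set (Set X), (∀ V ∈ U, IsOpen V) → ⋃₀ U = univ →
    ∃ W ⊆ U, #W ≤ κ ∧ ⋃₀ W = univ}

/-- The hereditary Lindelöf number: the supremum of the Lindelöf numbers of all subspaces. -/
def hereditaryLindelofNumber (X : Type u) [TopologicalSpace X] : Cardinal.{u} :=
  ⨆ Z : Set X, lindelofNumber Z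

/-- The density: the smallest cardinality of a dense subset. -/
def density (X : Type u) [TopologicalSpace X] : Cardinal.{u} :=
  sInf {κ | ∃ D : Set X, Dense D ∧ #D = κ}

/-- The hereditary density: the supremum of the densities of all subspaces. -/
def hereditaryDensity (X : Type u) [TopologicalSpace X] : Cardinal.{u} :=
  ⨆ Z : Set X, density Z

/-- `K` is a compact convex subset of the space of scatteredly continuous real-valued functions
on `X` with the topology of pointwise convergence. -/
def IsCompactConvexIn (X : Type u) [TopologicalSpace X] (K : Set (X → ℝ)) : Prop :=
  K ⊆ scatteredlyContinuousFunctions X ∧ IsCompact K ∧ Convex ℝ K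

end SCp

end

namespace SCp

open Filter Topology

/-! Upper bound: where `K` is uniformly bounded on `A`, all its members are continuous on one
non-empty relatively open part of `A` (`IsCompactConvexIn.exists_isOpen_forall_continuousWithinAt`).
Otherwise countable tightness gives a countable `Q ⊆ A` with a dense set of points at which some
member of `K`, restricted to `Q`, is discontinuous. Baire category in the uniform metric, with
convexity supplying perturbations, merges these into one member discontinuous at all of them,
against scattered continuity. Exhausting `A` by open sets, `hl` bounds the number of pieces and `hd`
the points determining `K` on each. Since `X` is a countable union of sets on which `K` is bounded,
few evaluations separate the points of `K`, and compactness bounds its weight.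

Lower bound: a well-ordered open family splits its union into blocks by least member; the cube of
functions constant on blocks is compact, convex and has weight at least the number of blocks. -/

/-! ### Common points of continuity -/

/-- A scatteredly continuous map into a regular space is continuous on some non-empty relatively
open subset of each non-empty set. -/
theorem ScatteredlyContinuous.exists_isOpen_continuousWithinAt {X Y : Type*} [TopologicalSpace X]
    [TopologicalSpace Y] [RegularSpace Y] {f : X → Y} (hf : ScatteredlyContinuous f) {A : Set X}
    (hA : A.Nonempty) :
    ∃ V : Set X, IsOpen V ∧ (V ∩ A).Nonempty ∧ ∀ x ∈ V ∩ A, ContinuousWithinAt f A x := by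
  by_contra! H
  set D : Set X := {x ∈ A | ¬ ContinuousWithinAt f A x} with hD
  have hdense : ∀ V : Set X, IsOpen V → (V ∩ A).Nonempty → (V ∩ D).Nonempty := by
    intro V hV hVA
    obtain ⟨x, hx, hxf⟩ := H V hV hVA
    exact ⟨x, hx.1, hx.2, hxf⟩
  have hDne : D.Nonempty :=
    (hdense univ isOpen_univ (by simpa using hA)).mono inter_subset_right
  obtain ⟨⟨y, hyD⟩, hy⟩ := hf D hDne
  rw [← continuousWithinAt_iff_continuousAt_domRestrict] at hy
  refine hyD.2 ?_
  intro N hN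
  -- Continuity along `D` at `y` lifts to `A`: a nearby `z ∈ A` with value outside the closed `C` is
  -- not in `D`, so `f` avoids `C` on `A` near `z`, yet `D` is dense there with values in `C`.
  obtain ⟨C, hCy, hCc, hCN⟩ := exists_mem_nhds_isClosed_subset hN
  obtain ⟨U, hU, hyU, hUC⟩ := mem_nhdsWithin.1 (hy hCy)
  refine mem_of_superset (mem_nhdsWithin.2 ⟨U, hU, hyU, ?_⟩) (preimage_mono hCN)
  rintro z ⟨hzU, hzA⟩
  by_contra hz
  have hzc : ContinuousWithinAt f A z := by
    by_contra hzc
    exact hz (hUC ⟨hzU, hzA, hzc⟩)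
  obtain ⟨W, hW, hzW, hWC⟩ := mem_nhdsWithin.1 (hzc (hCc.isOpen_compl.mem_nhds hz))
  obtain ⟨w, ⟨hwW, hwU⟩, hwD⟩ := hdense (W ∩ U) (hW.inter hU) ⟨z, ⟨hzW, hzU⟩, hzA⟩
  exact hWC ⟨hwW, hwD.1⟩ (hUC ⟨hwU, hwD⟩)

/-- In a uniformly bounded compact convex set of functions, countably many points of discontinuity
of members of the set are points of discontinuity of a single member. -/
theorem exists_mem_forall_not_continuousAt {T : Type*} [TopologicalSpace T] {K : Set (T → ℝ)}
    (hK : IsCompact K) (hconv : Convex ℝ K) (hne : K.Nonempty) {m : ℝ}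
    (hm : ∀ f ∈ K, ∀ x, |f x| ≤ m) {S : Set T} (hS : S.Countable)
    (h : ∀ y ∈ S, ∃ g ∈ K, ¬ ContinuousAt g y) :
    ∃ f ∈ K, ∀ y ∈ S, ¬ ContinuousAt f y := by
  -- Pointwise closedness makes `K` complete for uniform convergence, so Baire's theorem applies to
  -- the sets `O y`.
  let K' : Set (UniformFun T ℝ) := UniformFun.toFun ⁻¹' K
  have hK'c : IsClosed K' := hK.isClosed.preimage UniformFun.uniformContinuous_toFun.continuous
  have : CompleteSpace K' := hK'c.completeSpace_coe
  have : Nonempty K' := ⟨⟨UniformFun.ofFun hne.some, hne.some_mem⟩⟩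
  let O : T → Set K' := fun y => {f | ¬ ContinuousAt (UniformFun.toFun f.1) y}
  have hnhds : ∀ (f : K') {ε : ℝ}, 0 < ε →
      {g : K' | ∀ x, dist (UniformFun.toFun f.1 x) (UniformFun.toFun g.1 x) < ε} ∈ 𝓝 f := by
    intro f ε hε
    have h1 := (UniformFun.hasBasis_nhds T ℝ f.1).mem_of_mem (Metric.dist_mem_uniformity hε)
    exact continuous_subtype_val.continuousAt h1
  have hO : ∀ y ∈ S, IsOpen (O y) := by
    intro y _
    rw [← isClosed_compl_iff]
    refine isClosed_of_closure_subset fun f hf => ?_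
    have hfc : ContinuousAt (UniformFun.toFun f.1) y := by
      refine continuousAt_of_locally_uniform_approx_of_continuousAt fun u hu => ?_
      obtain ⟨ε, hε, hεu⟩ := Metric.mem_uniformity_dist.1 hu
      obtain ⟨g, hg, hgO⟩ := mem_closure_iff_nhds.1 hf _ (hnhds f hε)
      exact ⟨univ, univ_mem, UniformFun.toFun g.1, not_not.1 hgO, fun x _ => hεu (hg x)⟩
    exact not_not.2 hfc
  have hd : ∀ y ∈ S, Dense (O y) := by
    intro y hy f
    by_cases hf : ContinuousAt (UniformFun.toFun f.1) y
    swap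
    · exact subset_closure hf
    obtain ⟨g, hgK, hg⟩ := h y hy
    -- A step of length `1 / (n + 1)` from `f` towards `g` moves values by at most `2 * m / (n +
    -- 1)`, and it destroys continuity at `y`, since `g` is recovered linearly from `p n` and `f`.
    let p : ℕ → K' := fun n => ⟨UniformFun.ofFun
      ((1 - 1 / ((n : ℝ) + 1)) • UniformFun.toFun f.1 + (1 / ((n : ℝ) + 1)) • g), by
        have h1 : (1 : ℝ) / ((n : ℝ) + 1) ≤ 1 := by
          rw [div_le_one (by positivity)]; linarith [(Nat.cast_nonneg n : (0 : ℝ) ≤ n)]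
        exact hconv f.2 hgK (by linarith) (by positivity) (by ring)⟩
    have hp : Tendsto p atTop (𝓝 f) := by
      rw [tendsto_subtype_rng, UniformFun.tendsto_iff_tendstoUniformly,
        Metric.tendstoUniformly_iff]
      intro ε hε
      have hlim : Tendsto (fun n : ℕ => (1 / ((n : ℝ) + 1)) * (2 * m)) atTop (𝓝 0) := by
        simpa using tendsto_one_div_add_atTop_nhds_zero_nat.mul_const (2 * m)
      filter_upwards [hlim.eventually_lt_const hε] with n hn x
      refine lt_of_le_of_lt ?_ hn
      have e : UniformFun.toFun f.1 x - (UniformFun.toFun (p n).1) x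
          = (1 / ((n : ℝ) + 1)) * (UniformFun.toFun f.1 x - g x) := by
        change _ - ((1 - 1 / ((n : ℝ) + 1)) * UniformFun.toFun f.1 x + (1 / ((n : ℝ) + 1)) * g x) = _
        ring
      change dist (UniformFun.toFun f.1 x) (UniformFun.toFun (p n).1 x) ≤ _
      rw [Real.dist_eq, e, abs_mul, abs_of_nonneg (by positivity : (0 : ℝ) ≤ 1 / ((n : ℝ) + 1))]
      refine mul_le_mul_of_nonneg_left ?_ (by positivity)
      have h1 := abs_sub (UniformFun.toFun f.1 x) (g x)
      have h2 : |UniformFun.toFun f.1 x| ≤ m := hm _ f.2 x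
      linarith [hm _ hgK x]
    refine mem_closure_of_tendsto hp (Eventually.of_forall fun n => ?_)
    intro hc
    refine hg ?_
    have h2 : g = fun x => ((n : ℝ) + 1) * (UniformFun.toFun (p n).1 x
        - (1 - 1 / ((n : ℝ) + 1)) * UniformFun.toFun f.1 x) := by
      funext x
      change _ = ((n : ℝ) + 1) * (((1 - 1 / ((n : ℝ) + 1)) * UniformFun.toFun f.1 x
        + (1 / ((n : ℝ) + 1)) * g x) - (1 - 1 / ((n : ℝ) + 1)) * UniformFun.toFun f.1 x)
      have : (n : ℝ) + 1 ≠ 0 := by positivity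
      field_simp
      ring
    rw [h2]
    exact continuousAt_const.mul (hc.sub (continuousAt_const.mul hf))
  obtain ⟨f, hf⟩ := (dense_biInter_of_isOpen hO hS hd).nonempty
  exact ⟨UniformFun.toFun f.1, f.2, fun y hy => mem_iInter₂.1 hf y hy⟩

/-- In a space of tightness at most `ℵ₀`, closures are determined by countable sets. -/
theorem exists_countable_subset_mem_closure {X : Type u} [TopologicalSpace X]
    (hX : tightness X ≤ ℵ₀) {A : Set X} {a : X} (ha : a ∈ closure A) :
    ∃ B ⊆ A, B.Countable ∧ a ∈ closure B := by
  have hne : {κ : Cardinal.{u} | ℵ₀ ≤ κ ∧ ∀ (A : Set X) (a : X), a ∈ closure A →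
      ∃ B ⊆ A, #B ≤ κ ∧ a ∈ closure B}.Nonempty :=
    ⟨max ℵ₀ #X, le_max_left _ _, fun A a ha =>
      ⟨A, Subset.rfl, (Cardinal.mk_set_le A).trans (le_max_right _ _), ha⟩⟩
  obtain ⟨B, hBA, hB, haB⟩ := (csInf_mem hne).2 A a ha
  exact ⟨B, hBA, Cardinal.le_aleph0_iff_set_countable.1 (hB.trans hX), haB⟩

/-- A set containing a given point and closed under a map to countable sets may be chosen
countable. -/
theorem exists_countable_closed_under {X : Type*} (x₀ : X) (c : X → Set X)
    (hc : ∀ x, (c x).Countable) : ∃ Q : Set X, Q.Countable ∧ x₀ ∈ Q ∧ ∀ x ∈ Q, c x ⊆ Q := by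
  let q : ℕ → Set X := fun n => Nat.rec {x₀} (fun _ s => ⋃ x ∈ s, c x) n
  have hq : ∀ n, (q n).Countable := by
    intro n
    induction n with
    | zero => exact countable_singleton x₀
    | succ n ih => exact ih.biUnion fun x _ => hc x
  refine ⟨⋃ n, q n, countable_iUnion hq, mem_iUnion.2 ⟨0, rfl⟩, fun x hx y hy => ?_⟩
  obtain ⟨n, hn⟩ := mem_iUnion.1 hx
  exact mem_iUnion.2 ⟨n + 1, mem_biUnion hn hy⟩

/-- A compact convex set of scatteredly continuous functions on a space of countable tightness,
uniformly bounded on a non-empty set `A`, consists of functions continuous on a common non-empty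
relatively open subset of `A`. -/
theorem IsCompactConvexIn.exists_isOpen_forall_continuousWithinAt {X : Type u}
    [TopologicalSpace X] (hX : tightness X ≤ ℵ₀) {K : Set (X → ℝ)} (hK : IsCompactConvexIn X K)
    {A : Set X} (hA : A.Nonempty) {m : ℝ} (hm : ∀ f ∈ K, ∀ x ∈ A, |f x| ≤ m) :
    ∃ V : Set X, IsOpen V ∧ (V ∩ A).Nonempty ∧
      ∀ f ∈ K, ∀ x ∈ V ∩ A, ContinuousWithinAt f A x := by
  by_contra! H
  obtain ⟨hsc, hcomp, hconv⟩ := hK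
  set E : Set X := {x ∈ A | ∃ f ∈ K, ¬ ContinuousWithinAt f A x} with hE
  have hAE : A ⊆ closure E := by
    intro x hx
    rw [mem_closure_iff]
    intro V hV hxV
    obtain ⟨f, hf, y, hy, hfy⟩ := H V hV ⟨x, hxV, hx⟩
    exact ⟨y, hy.1, hy.2, f, hf, hfy⟩
  -- `c x` contains countably many points of `E` accumulating at `x` and, for `x ∈ E`, countably
  -- many witnessing a discontinuity at `x` that persists in every `Q ⊇ c x`.
  have hc : ∀ x, ∃ c : Set X, c.Countable ∧ c ⊆ A ∧ (x ∈ A → x ∈ closure (c ∩ E)) ∧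
      (x ∈ E → ∃ f ∈ K, ∀ Q : Set X, c ⊆ Q → ¬ ContinuousWithinAt f Q x) := by
    intro x
    by_cases hxA : x ∈ A
    swap
    · exact ⟨∅, countable_empty, empty_subset _, fun h => absurd h hxA, fun h => absurd h.1 hxA⟩
    obtain ⟨B, hBE, hB, hxB⟩ := exists_countable_subset_mem_closure hX (hAE hxA)
    by_cases hxE : x ∈ E
    swap
    · exact ⟨B, hB, fun y hy => (hBE hy).1,
        fun _ => by rwa [inter_eq_left.2 hBE], fun h => absurd h hxE⟩
    obtain ⟨f, hf, hfx⟩ := hxE.2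
    obtain ⟨N, hN, hfN⟩ : ∃ N ∈ 𝓝 (f x), f ⁻¹' N ∉ 𝓝[A] x := by
      by_contra! h
      exact hfx h
    have hx : x ∈ closure (A \ f ⁻¹' N) := by
      rw [mem_closure_iff]
      intro U hU hxU
      by_contra he
      refine hfN (mem_nhdsWithin.2 ⟨U, hU, hxU, fun y hy => ?_⟩)
      by_contra hyN
      exact he ⟨y, hy.1, hy.2, hyN⟩
    obtain ⟨C, hCA, hC, hxC⟩ := exists_countable_subset_mem_closure hX hx
    refine ⟨B ∪ C, hB.union hC, union_subset (fun y hy => (hBE hy).1) fun y hy => (hCA hy).1,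
      fun _ => closure_mono (subset_inter subset_union_left hBE) hxB, fun _ => ⟨f, hf, ?_⟩⟩
    intro Q hQ hcont
    obtain ⟨U, hU, hxU, hUN⟩ := mem_nhdsWithin.1 (hcont hN)
    obtain ⟨y, hyU, hyC⟩ := mem_closure_iff.1 hxC U hU hxU
    exact (hCA hyC).2 (hUN ⟨hyU, hQ (Or.inr hyC)⟩)
  choose c hcc hcA hcE hcK using hc
  obtain ⟨x₀, hx₀⟩ := hA
  obtain ⟨P, hPc, hxP, hP⟩ := exists_countable_closed_under x₀ c hcc
  set Q := P ∩ A with hQdef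
  have hQc : Q.Countable := hPc.mono inter_subset_left
  have hcQ : ∀ x ∈ Q, c x ⊆ Q := fun x hx => subset_inter (hP x hx.1) (hcA x)
  have : Countable Q := hQc.to_subtype
  let r : (X → ℝ) → (Q → ℝ) := fun f => Q.domRestrict f
  have hr : Continuous r := by
    refine continuous_pi fun x => ?_
    exact continuous_apply (x : X)
  have hKr : Convex ℝ (r '' K) := by
    rintro _ ⟨f, hf, rfl⟩ _ ⟨g, hg, rfl⟩ a b ha hb hab
    exact ⟨a • f + b • g, hconv hf hg ha hb hab, rfl⟩
  obtain ⟨f₀, hf₀, -⟩ := H univ isOpen_univ ⟨x₀, trivial, hx₀⟩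
  obtain ⟨_, ⟨f, hf, rfl⟩, hdisc⟩ := exists_mem_forall_not_continuousAt (hcomp.image hr) hKr
    (Set.Nonempty.image r (s := K) ⟨f₀, hf₀⟩) (m := m)
    (by rintro _ ⟨f, hf, rfl⟩ x; exact hm f hf x x.2.2)
    (S := {y : Q | (y : X) ∈ E}) (Set.to_countable _) (by
      rintro y hy
      obtain ⟨f, hf, hfy⟩ := hcK y hy
      refine ⟨r f, mem_image_of_mem r hf, fun h => hfy Q (hcQ y y.2) ?_⟩
      exact (continuousWithinAt_iff_continuousAt_domRestrict f y.2).2 h)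
  obtain ⟨V, hV, ⟨x, hxV, hxQ⟩, hVf⟩ :=
    (hsc hf).exists_isOpen_continuousWithinAt (A := Q) ⟨x₀, hxP, hx₀⟩
  -- `E ∩ Q` is dense in `Q`, so it meets the open piece on which `f` is continuous.
  obtain ⟨y, hyV, hyc, hyE⟩ := mem_closure_iff.1 (hcE x hxQ.2) V hV hxV
  have hyQ : y ∈ Q := hcQ x hxQ hyc
  exact hdisc ⟨y, hyQ⟩ hyE
    ((continuousWithinAt_iff_continuousAt_domRestrict f hyQ).1 (hVf y ⟨hyV, hyQ⟩))

/-! ### Small determining sets from `hl` and `hd` -/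

/-- The infimum of a non-empty set of cardinals is attained; `max ℵ₀ #(Set X)` is a member, as every
cover is its own subcover. -/
theorem aleph0_le_lindelofNumber_and_exists_subcover (X : Type u) [TopologicalSpace X] :
    ℵ₀ ≤ lindelofNumber X ∧ ∀ U : Set (Set X), (∀ V ∈ U, IsOpen V) → ⋃₀ U = univ →
      ∃ W ⊆ U, #W ≤ lindelofNumber X ∧ ⋃₀ W = univ :=
  csInf_mem (s := {κ | ℵ₀ ≤ κ ∧ ∀ U : Set (Set X), (∀ V ∈ U, IsOpen V) → ⋃₀ U = univ →
    ∃ W ⊆ U, #W ≤ κ ∧ ⋃₀ W = univ}) ⟨max ℵ₀ #(Set X), le_max_left _ _, fun U _ hU =>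
      ⟨U, Subset.rfl, (Cardinal.mk_set_le U).trans (le_max_right _ _), hU⟩⟩

theorem lindelofNumber_le_hereditaryLindelofNumber {X : Type u} [TopologicalSpace X] (Z : Set X) :
    lindelofNumber Z ≤ hereditaryLindelofNumber X :=
  le_ciSup (f := fun Z : Set X => lindelofNumber Z) (Cardinal.bddAbove_of_small) Z

theorem aleph0_le_hereditaryLindelofNumber (X : Type u) [TopologicalSpace X] :
    ℵ₀ ≤ hereditaryLindelofNumber X :=
  (aleph0_le_lindelofNumber_and_exists_subcover _).1.trans
    (lindelofNumber_le_hereditaryLindelofNumber (univ : Set X))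

/-- Each family of open sets has a subfamily of cardinality at most `hl(X)` with the same union. -/
theorem exists_subfamily_sUnion_eq {X : Type u} [TopologicalSpace X] {U : Set (Set X)}
    (hU : ∀ V ∈ U, IsOpen V) :
    ∃ W ⊆ U, #W ≤ hereditaryLindelofNumber X ∧ ⋃₀ W = ⋃₀ U := by
  set Z : Set X := ⋃₀ U with hZ
  let p : Set X → Set Z := fun V => Subtype.val ⁻¹' V
  obtain ⟨W, hWU, hWc, hW⟩ := (aleph0_le_lindelofNumber_and_exists_subcover Z).2 (p '' U)
    (by rintro _ ⟨V, hV, rfl⟩; exact (hU V hV).preimage continuous_subtype_val)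
    (by
      refine eq_univ_of_forall fun x => ?_
      obtain ⟨V, hV, hxV⟩ := x.2
      exact ⟨p V, mem_image_of_mem p hV, hxV⟩)
  have hex : ∀ w : W, ∃ V ∈ U, p V = w := fun w => hWU w.2
  choose s hsU hs using hex
  refine ⟨range s, range_subset_iff.2 hsU, Cardinal.mk_range_le.trans
    (hWc.trans (lindelofNumber_le_hereditaryLindelofNumber Z)), Subset.antisymm ?_ ?_⟩
  · exact sUnion_subset_sUnion (range_subset_iff.2 hsU)
  · intro x hx
    obtain ⟨w, hw, hxw⟩ := mem_sUnion.1 (hW.symm ▸ mem_univ (⟨x, hx⟩ : Z))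
    refine ⟨s ⟨w, hw⟩, mem_range_self _, ?_⟩
    have hxs : (⟨x, hx⟩ : Z) ∈ p (s ⟨w, hw⟩) := (hs ⟨w, hw⟩).symm ▸ hxw
    exact hxs

/-- Each set has a dense subset of cardinality at most `hd(X)`. -/
theorem exists_subset_closure_card_le {X : Type u} [TopologicalSpace X] (Z : Set X) :
    ∃ D ⊆ Z, #D ≤ hereditaryDensity X ∧ Z ⊆ closure D := by
  obtain ⟨D, hD, hDc⟩ : ∃ D : Set Z, Dense D ∧ #D = density Z :=
    csInf_mem (s := {κ | ∃ D : Set Z, Dense D ∧ #D = κ}) ⟨_, univ, dense_univ, rfl⟩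
  refine ⟨Subtype.val '' D, by rintro _ ⟨x, -, rfl⟩; exact x.2, ?_, fun x hx => ?_⟩
  · exact Cardinal.mk_image_le.trans (hDc.le.trans
      (le_ciSup (f := fun Z : Set X => density Z) (Cardinal.bddAbove_of_small) Z))
  · exact image_closure_subset_closure_image continuous_subtype_val
      (mem_image_of_mem Subtype.val (hD ⟨x, hx⟩))

/-- A compact convex set of scatteredly continuous functions, uniformly bounded on `A`, is
determined on `A` by at most `max (hl(X), hd(X))` points. -/
theorem IsCompactConvexIn.exists_card_le_eqOn {X : Type u} [TopologicalSpace X]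
    (hX : tightness X ≤ ℵ₀) {K : Set (X → ℝ)} (hK : IsCompactConvexIn X K) {A : Set X} {m : ℝ}
    (hm : ∀ f ∈ K, ∀ x ∈ A, |f x| ≤ m) :
    ∃ D : Set X, #D ≤ max (hereditaryLindelofNumber X) (hereditaryDensity X) ∧
      ∀ f ∈ K, ∀ g ∈ K, EqOn f g D → EqOn f g A := by
  set κ := max (hereditaryLindelofNumber X) (hereditaryDensity X) with hκ
  have hκ₀ : ℵ₀ ≤ κ := (aleph0_le_hereditaryLindelofNumber X).trans (le_max_left _ _)
  -- By `hl`, at most `κ` members of `U` cover `⋃₀ U`, so `K` is determined on `⋃₀ U ∩ A` by `κ`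
  -- points; it remains to see that `U` covers `A`.
  let U : Set (Set X) := {V | IsOpen V ∧ ∃ D : Set X, #D ≤ κ ∧
    ∀ f ∈ K, ∀ g ∈ K, EqOn f g D → EqOn f g (V ∩ A)}
  have hU : ∀ V ∈ U, IsOpen V := fun V hV => hV.1
  obtain ⟨W, hWU, hWc, hW⟩ := exists_subfamily_sUnion_eq hU
  have hD : ∀ V : W, ∃ D : Set X, #D ≤ κ ∧ ∀ f ∈ K, ∀ g ∈ K, EqOn f g D → EqOn f g (V ∩ A) :=
    fun V => (hWU V.2).2
  choose d hdc hd using hD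
  have hdκ : #(⋃ V, d V : Set X) ≤ κ := by
    refine (Cardinal.mk_iUnion_le d).trans ?_
    refine (mul_le_mul' (hWc.trans (le_max_left _ (hereditaryDensity X))) (ciSup_le' hdc)).trans ?_
    exact (Cardinal.mul_eq_self hκ₀).le
  have hG : ∀ f ∈ K, ∀ g ∈ K, EqOn f g (⋃ V, d V) → EqOn f g (⋃₀ U ∩ A) := by
    rintro f hf g hg hfg x ⟨hx, hxA⟩
    rw [← hW] at hx
    obtain ⟨V, hV, hxV⟩ := hx
    exact hd ⟨V, hV⟩ f hf g hg (hfg.mono (subset_iUnion d _)) ⟨hxV, hxA⟩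
  by_cases hA : (A \ ⋃₀ U).Nonempty
  · exfalso
    obtain ⟨V, hV, ⟨x, hxV, hxA, hxU⟩, hVc⟩ := hK.exists_isOpen_forall_continuousWithinAt hX hA
      (fun f hf x hx => hm f hf x hx.1)
    -- A dense `D` in this piece determines `K` there by continuity; adding the points already used
    -- for `⋃₀ U` puts `V` itself in `U`, a contradiction.
    obtain ⟨D, hDV, hDc, hVD⟩ := exists_subset_closure_card_le (V ∩ (A \ ⋃₀ U))
    refine hxU ⟨V, ⟨hV, (⋃ V, d V) ∪ D, ?_, ?_⟩, hxV⟩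
    · refine (Cardinal.mk_union_le _ _).trans ?_
      exact (add_le_add hdκ (hDc.trans (le_max_right _ _))).trans (Cardinal.add_eq_self hκ₀).le
    · intro f hf g hg hfg y hy
      by_cases hyU : y ∈ ⋃₀ U
      · exact hG f hf g hg (hfg.mono subset_union_left) ⟨hyU, hy.2⟩
      have hyV : y ∈ V ∩ (A \ ⋃₀ U) := ⟨hy.1, hy.2, hyU⟩
      have : (𝓝[D] y).NeBot := mem_closure_iff_nhdsWithin_neBot.1 (hVD hyV)
      have hDA : D ⊆ A \ ⋃₀ U := hDV.trans inter_subset_right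
      refine tendsto_nhds_unique (((hVc f hf y hyV).mono hDA).congr' ?_) ((hVc g hg y hyV).mono hDA)
      exact eventually_nhdsWithin_of_forall fun z hz => hfg (Or.inr hz)
  · refine ⟨_, hdκ, fun f hf g hg hfg x hx => hG f hf g hg hfg ⟨?_, hx⟩⟩
    by_contra hxU
    exact hA ⟨x, hx, hxU⟩

/-! ### Weight estimates and the upper bound -/

theorem weight_le_of_isTopologicalBasis {X : Type u} [TopologicalSpace X] {B : Set (Set X)}
    (hB : IsTopologicalBasis B) : weight X ≤ #B :=
  csInf_le' ⟨B, hB, rfl⟩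

theorem exists_isTopologicalBasis_card_eq_weight (X : Type u) [TopologicalSpace X] :
    ∃ B : Set (Set X), IsTopologicalBasis B ∧ #B = weight X :=
  csInf_mem (s := {κ | ∃ B : Set (Set X), IsTopologicalBasis B ∧ #B = κ})
    ⟨_, _, isTopologicalBasis_opens, rfl⟩

/-- Finite intersections of subbasic sets form a base, and an infinite `κ` absorbs the passage to
finite subsets. -/
theorem weight_le_of_eq_generateFrom {X : Type u} [t : TopologicalSpace X] {S : Set (Set X)}
    (hS : t = generateFrom S) {κ : Cardinal.{u}} (hκ : ℵ₀ ≤ κ) (hSκ : #S ≤ κ) : weight X ≤ κ := by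
  refine (weight_le_of_isTopologicalBasis (isTopologicalBasis_of_subbasis hS)).trans ?_
  have hsub : (fun f => ⋂₀ f) '' {f : Set (Set X) | f.Finite ∧ f ⊆ S} ⊆
      range fun F : Finset S => ⋂₀ (Subtype.val '' (F : Set S)) := by
    rintro _ ⟨f, ⟨hf, hfS⟩, rfl⟩
    have hfin : (Subtype.val ⁻¹' f : Set S).Finite := hf.preimage Subtype.val_injective.injOn
    refine ⟨hfin.toFinset, ?_⟩
    simp only [Finite.coe_toFinset, Subtype.image_preimage_coe, inter_eq_right.2 hfS]
  refine (Cardinal.mk_le_mk_of_subset hsub).trans (Cardinal.mk_range_le.trans ?_)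
  rcases finite_or_infinite S with h | h
  · exact (Cardinal.lt_aleph0_of_finite _).le.trans hκ
  · rwa [Cardinal.mk_finset_of_infinite]

/-- The weight of a compact space is at most the number of continuous real-valued functions
needed to separate its points. -/
theorem weight_le_of_separating {Y ι : Type u} [TopologicalSpace Y] [CompactSpace Y]
    (e : Y → ι → ℝ) (he : Continuous e) (hinj : Function.Injective e) {κ : Cardinal.{u}}
    (hκ : ℵ₀ ≤ κ) (hι : #ι ≤ κ) : weight Y ≤ κ := by
  -- A continuous injection of a compact space into a Hausdorff one is an embedding, so preimages of
  -- basic open sets under the coordinates form a subbase.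
  have hind := (he.isClosedEmbedding hinj).isInducing.eq_induced
  obtain ⟨b, hbc, -, hb⟩ := exists_countable_basis ℝ
  have : Countable b := hbc.to_subtype
  let s : ι × ULift.{u} b → Set Y := fun p => (fun y => e y p.1) ⁻¹' p.2.down.1
  refine weight_le_of_eq_generateFrom (S := range s) ?_ hκ ?_
  · rw [hind, Pi.topologicalSpace, induced_iInf]
    simp only [hb.eq_generateFrom, induced_generateFrom_eq,
      ← generateFrom_iUnion]
    congr 1
    ext V
    simp only [mem_iUnion, mem_image, mem_range, Prod.exists, ULift.exists, Subtype.exists, s,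
      exists_exists_and_eq_and, exists_prop, preimage_preimage]
  · refine Cardinal.mk_range_le.trans ?_
    rw [Cardinal.mk_prod, Cardinal.lift_id, Cardinal.lift_id]
    exact (mul_le_mul' hι ((Cardinal.mk_le_aleph0).trans hκ)).trans (Cardinal.mul_eq_self hκ).le

/-- A discrete subset indexed injectively by `ι` bounds the weight from below. -/
theorem card_le_weight {Y ι : Type u} [TopologicalSpace Y] (s : ι → Y) (O : ι → Set Y)
    (hO : ∀ i, IsOpen (O i)) (hs : ∀ i, s i ∈ O i) (hd : ∀ i j, s j ∈ O i → j = i) :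
    #ι ≤ weight Y := by
  obtain ⟨B, hB, hBw⟩ := exists_isTopologicalBasis_card_eq_weight Y
  rw [← hBw]
  have h : ∀ i, ∃ b : B, s i ∈ b.1 ∧ b.1 ⊆ O i := fun i => by
    obtain ⟨b, hb, h⟩ := hB.exists_subset_of_mem_open (hs i) (hO i)
    exact ⟨⟨b, hb⟩, h⟩
  choose b hsb hbO using h
  exact Cardinal.mk_le_of_injective (f := b) fun i j hij => hd j i (hbO j (hij ▸ hsb i))

/-- Evaluation at each point is bounded on the compact `K`, so the countably many sets `{x | ∀ f ∈
K, |f x| ≤ n}` cover `X`; the union of their determining sets separates the points of `K`. -/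
theorem IsCompactConvexIn.weight_le {X : Type u} [TopologicalSpace X] (hX : tightness X ≤ ℵ₀)
    {K : Set (X → ℝ)} (hK : IsCompactConvexIn X K) :
    weight K ≤ max (hereditaryLindelofNumber X) (hereditaryDensity X) := by
  set κ := max (hereditaryLindelofNumber X) (hereditaryDensity X) with hκ
  have hκ₀ : ℵ₀ ≤ κ := (aleph0_le_hereditaryLindelofNumber X).trans (le_max_left _ _)
  have hD : ∀ n : ULift.{u} ℕ, ∃ D : Set X, #D ≤ κ ∧ ∀ f ∈ K, ∀ g ∈ K, EqOn f g D →
      EqOn f g {x | ∀ f ∈ K, |f x| ≤ n.down} := fun n =>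
    hK.exists_card_le_eqOn hX fun f hf x hx => hx f hf
  choose d hdc hd using hD
  have : CompactSpace K := isCompact_iff_compactSpace.1 hK.2.1
  refine weight_le_of_separating (ι := (⋃ n, d n : Set X)) (fun f x => f.1 x)
    (continuous_pi fun x => (continuous_apply (x : X)).comp continuous_subtype_val) ?_ hκ₀ ?_
  · rintro ⟨f, hf⟩ ⟨g, hg⟩ hfg
    refine Subtype.ext (funext fun x => ?_)
    obtain ⟨C, hC⟩ := (hK.2.1.image (continuous_apply x)).isBounded.exists_norm_le
    obtain ⟨n, hn⟩ := exists_nat_ge C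
    refine hd ⟨n⟩ f hf g hg (fun y hy => ?_) fun h hh => ?_
    · exact congrFun hfg ⟨y, mem_iUnion.2 ⟨_, hy⟩⟩
    · exact (hC _ (mem_image_of_mem (fun f : X → ℝ => f x) hh)).trans hn
  · refine (Cardinal.mk_iUnion_le d).trans ?_
    exact (mul_le_mul' (Cardinal.mk_le_aleph0.trans hκ₀) (ciSup_le' hdc)).trans
      (Cardinal.mul_eq_self hκ₀).le

/-! ### The lower bound -/

/-- Each family `U` of open sets has a subfamily with the same union whose cardinality is at most
the weight of a compact convex set of scatteredly continuous functions. After well-ordering `U`,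
the latter consists of the functions with values in `[0, 1]` that vanish off `⋃₀ U` and depend on
`⋃₀ U` only on the least member of `U` containing the argument. -/
theorem exists_isCompactConvexIn_card_le_weight {X : Type u} [TopologicalSpace X]
    {U : Set (Set X)} (hU : ∀ V ∈ U, IsOpen V) :
    ∃ W ⊆ U, ⋃₀ W = ⋃₀ U ∧ ∃ K : Set (X → ℝ), IsCompactConvexIn X K ∧ #W ≤ weight K := by
  classical
  let R : U → U → Prop := WellOrderingRel
  have hRwf : WellFounded R := WellOrderingRel.isWellOrder.wf
  have hex : ∀ x : (⋃₀ U : Set X), ∃ V : U, x.1 ∈ V.1 ∧ ∀ V' : U, x.1 ∈ V'.1 → ¬ R V' V := by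
    rintro ⟨x, V, hV, hxV⟩
    obtain ⟨V₀, h, h'⟩ := hRwf.has_min {V : U | x ∈ V.1} ⟨⟨V, hV⟩, hxV⟩
    exact ⟨V₀, h, h'⟩
  choose μ hμ hmin using hex
  let ext : (U → ℝ) → X → ℝ := fun g x => if h : x ∈ ⋃₀ U then g (μ ⟨x, h⟩) else 0
  have hext : ∀ (g : U → ℝ) (x : (⋃₀ U : Set X)), ext g x = g (μ x) := fun g x => dif_pos x.2
  have hcont : Continuous ext := by
    refine continuous_pi fun x => ?_
    by_cases h : x ∈ ⋃₀ U
    · simpa only [ext, dif_pos h] using continuous_apply _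
    · simpa only [ext, dif_neg h] using continuous_const
  let C : Set (U → ℝ) := univ.pi fun _ => Icc (0 : ℝ) 1
  have hC : IsCompact C := isCompact_univ_pi fun _ => isCompact_Icc
  have hCconv : Convex ℝ C := convex_pi fun _ _ => convex_Icc 0 1
  have hK : IsCompactConvexIn X (ext '' C) := by
    refine ⟨?_, hC.image hcont, ?_⟩
    · rintro _ ⟨g, -, rfl⟩ A ⟨a, ha⟩
      by_cases hAU : (A ∩ ⋃₀ U).Nonempty
      · obtain ⟨y₀, hy₀A, hy₀U⟩ := hAU
        -- Take `y ∈ A` with `μ y` least. A point of `A` in the open set `μ y` has no larger index,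
        -- hence the same one, so the function is constant on `A` near `y`.
        obtain ⟨V, ⟨⟨y, hyU⟩, hyA, rfl⟩, hVmin⟩ := hRwf.has_min
          (μ '' (Subtype.val ⁻¹' A)) ⟨_, mem_image_of_mem μ (show ⟨y₀, hy₀U⟩ ∈ _ from hy₀A)⟩
        refine ⟨⟨y, hyA⟩, ?_⟩
        rw [← continuousWithinAt_iff_continuousAt_domRestrict]
        refine (continuousWithinAt_const (b := ext g y)).congr_of_eventuallyEq ?_ rfl
        refine mem_nhdsWithin.2 ⟨(μ ⟨y, hyU⟩).1, hU _ (μ _).2, hμ ⟨y, hyU⟩, ?_⟩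
        rintro z ⟨hzV, hzA⟩
        have hzU : z ∈ ⋃₀ U := ⟨_, (μ ⟨y, hyU⟩).2, hzV⟩
        have h1 := hmin ⟨z, hzU⟩ _ hzV
        have h2 := hVmin _ (mem_image_of_mem μ (show ⟨z, hzU⟩ ∈ _ from hzA))
        have h3 : μ ⟨z, hzU⟩ = μ ⟨y, hyU⟩ := by
          rcases trichotomous_of R (μ ⟨z, hzU⟩) (μ ⟨y, hyU⟩) with h | h | h
          · exact absurd h h2
          · exact h
          · exact absurd h h1
        change ext g z = ext g y
        rw [hext g ⟨z, hzU⟩, hext g ⟨y, hyU⟩, h3]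
      · refine ⟨⟨a, ha⟩, ?_⟩
        have h0 : A.domRestrict (ext g) = fun _ => 0 := by
          funext x
          exact dif_neg fun h => hAU ⟨x, x.2, h⟩
        rw [h0]
        exact continuousAt_const
    · rintro _ ⟨g, hg, rfl⟩ _ ⟨h, hh, rfl⟩ a b ha hb hab
      refine ⟨a • g + b • h, hCconv hg hh ha hb hab, ?_⟩
      funext x
      by_cases hx : x ∈ ⋃₀ U
      · simp only [ext, dif_pos hx, Pi.add_apply, Pi.smul_apply]
      · simp only [ext, dif_neg hx, Pi.add_apply, Pi.smul_apply, smul_zero, add_zero]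
  refine ⟨range fun x => (μ x).1, ?_, Subset.antisymm ?_ ?_, ext '' C, hK, ?_⟩
  · rintro _ ⟨x, rfl⟩
    exact (μ x).2
  · rintro x ⟨_, ⟨y, rfl⟩, hx⟩
    exact ⟨_, (μ y).2, hx⟩
  · exact fun x hx => ⟨_, ⟨⟨x, hx⟩, rfl⟩, hμ ⟨x, hx⟩⟩
  · have hcard : #(range fun x => (μ x).1) ≤ #(range μ) := by
      rw [show (fun x => (μ x).1) = Subtype.val ∘ μ from rfl, range_comp]
      exact Cardinal.mk_image_le
    refine hcard.trans ?_
    have hsec : ∀ V : range μ, ∃ x, μ x = V.1 := fun V => V.2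
    choose x hx using hsec
    -- The indicators of the blocks form a discrete subset: evaluating at a point of one block
    -- isolates its indicator from the others.
    refine card_le_weight (ι := range μ)
      (fun V => ⟨ext (Pi.single V.1 1), mem_image_of_mem ext fun V' _ => ?_⟩)
      (fun V => {f | 0 < f.1 (x V)}) (fun V => ?_) (fun V => ?_) fun V V' h => ?_
    · by_cases h : V' = V.1
      · subst h; simp
      · simp [h]
    · exact isOpen_lt continuous_const ((continuous_apply _).comp continuous_subtype_val)
    · simp [hext, hx]
    · by_contra hne
      have hne' : V.1 ≠ V'.1 := fun h => hne (Subtype.ext h.symm)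
      simp [hext, hx, hne'] at h

/-- The constant functions with values in `[0, 1]` form a compact convex set of infinite weight. -/
theorem exists_isCompactConvexIn_aleph0_le_weight (X : Type u) [TopologicalSpace X] [Nonempty X] :
    ∃ K : Set (X → ℝ), IsCompactConvexIn X K ∧ ℵ₀ ≤ weight K := by
  obtain ⟨x₀⟩ := ‹Nonempty X›
  let c : ℝ → X → ℝ := fun r _ => r
  have hc : Continuous c := continuous_pi fun _ => continuous_id
  refine ⟨c '' Icc 0 1, ⟨?_, isCompact_Icc.image hc, ?_⟩, ?_⟩
  · rintro _ ⟨r, -, rfl⟩ A ⟨a, ha⟩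
    exact ⟨⟨a, ha⟩, continuousAt_const⟩
  · rintro _ ⟨r, hr, rfl⟩ _ ⟨s, hs, rfl⟩ a b ha hb hab
    exact ⟨a • r + b • s, convex_Icc 0 1 hr hs ha hb hab, rfl⟩
  · obtain ⟨B, hB, hBw⟩ := exists_isTopologicalBasis_card_eq_weight (c '' Icc (0 : ℝ) 1)
    rw [← hBw]
    by_contra! hfin
    have : Finite B := Cardinal.lt_aleph0_iff_finite.1 hfin
    -- In a T₀ space a point is determined by the basic sets containing it, so a finite base allows
    -- only finitely many points.
    have hinj : Function.Injective fun f : c '' Icc (0 : ℝ) 1 => {b : B | f ∈ b.1} :=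
      fun f g hfg => hB.eq_iff.2 fun b hb => Set.ext_iff.1 hfg ⟨b, hb⟩
    have hcinj : Function.Injective c := fun r s h => congrFun h x₀
    exact ((Icc_infinite (zero_lt_one' ℝ)).image hcinj.injOn)
      (Set.finite_coe_iff.1 (Finite.of_injective _ hinj))

end SCp

theorem mainTheorem4 {X : Type u} [TopologicalSpace X] (hX : SCp.tightness X ≤ ℵ₀) :
    (∀ K : Set (X → ℝ), SCp.IsCompactConvexIn X K →
      SCp.weight K ≤ max (SCp.hereditaryLindelofNumber X) (SCp.hereditaryDensity X)) ∧
    (Nonempty X → SCp.hereditaryLindelofNumber X ≤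
      ⨆ K : {K : Set (X → ℝ) // SCp.IsCompactConvexIn X K}, SCp.weight K.1) ∧
    (⨆ K : {K : Set (X → ℝ) // SCp.IsCompactConvexIn X K}, SCp.weight K.1) ≤
      max (SCp.hereditaryLindelofNumber X) (SCp.hereditaryDensity X) := by
  refine ⟨fun K hK => hK.weight_le hX, fun hne => ?_, ciSup_le' fun K => K.2.weight_le hX⟩
  have hle : ∀ K (hK : SCp.IsCompactConvexIn X K), SCp.weight K ≤
      ⨆ K : {K : Set (X → ℝ) // SCp.IsCompactConvexIn X K}, SCp.weight K.1 := fun K hK =>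
    le_ciSup (f := fun K : {K : Set (X → ℝ) // SCp.IsCompactConvexIn X K} => SCp.weight K.1)
      (Cardinal.bddAbove_of_small) ⟨K, hK⟩
  -- Lindelöf numbers are infinite by definition, so the supremum must be shown to be at least `ℵ₀`,
  -- which uses a point of `X`. A cover of `Z` is handled through the open sets of `X` whose traces
  -- on `Z` belong to it.
  refine ciSup_le' fun Z => csInf_le' ⟨?_, fun U hU hUZ => ?_⟩
  · obtain ⟨K, hK, h⟩ := SCp.exists_isCompactConvexIn_aleph0_le_weight X
    exact h.trans (hle K hK)
  · obtain ⟨W, hWU, hW, K, hK, hWK⟩ := SCp.exists_isCompactConvexIn_card_le_weight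
      (U := {V : Set X | IsOpen V ∧ (Subtype.val ⁻¹' V : Set Z) ∈ U}) fun V hV => hV.1
    refine ⟨(fun V => Subtype.val ⁻¹' V) '' W, image_subset_iff.2 fun V hV => (hWU hV).2,
      Cardinal.mk_image_le.trans (hWK.trans (hle K hK)), eq_univ_of_forall fun z => ?_⟩
    obtain ⟨V, hV, hzV⟩ := mem_sUnion.1 (hUZ.symm ▸ mem_univ z)
    obtain ⟨O, hO, rfl⟩ := isOpen_induced_iff.1 (hU V hV)
    obtain ⟨O', hO', hzO'⟩ := mem_sUnion.1 (hW.symm ▸ mem_sUnion.2 ⟨O, ⟨hO, hV⟩, hzV⟩ : z.1 ∈ ⋃₀ W)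
    exact ⟨_, mem_image_of_mem _ hO', hzO'⟩
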